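/- Let $\mathbb{R}_+=[0,\infty)$. A \emph{generalised signed Radon measure} on $\mathbb{R}_+$ is a map $\mu:\mathscr{B}(\mathbb{R}_+)\to\mathbb{R}\cup\{\infty\}$ for which there are mutually singular Radon measures $\mu^+,\mu^-$ on $\mathbb{R}_+$ (i.e. locally finite and inner regular positive measures) such that, for every Borel set $A$, $\mu(A)=\mu^+(A)-\mu^-(A)$ if both $\mu^+(A)$ and $\mu^-(A)$ are finite, and $\mu(A)=+\infty$ otherwise. Put $|\mu|:=\mu^++\mu^-$, and let $F_\mu(0):=0$, $F_\mu(x):=\mu([0,x])$ for $x>0$. Let $\mathcal{M}_\Psi$ be the set of all such $\mu$ with $\int_{\mathbb{R}_+}e^{-\lambda x}\,|\mu|(\mathrm{d}x)<\infty$ for all $\lambda>0$; for $\mu\in\mathcal{M}_\Psi$ the Laplace transform is $\Psi_\mu(\lambda):=\int_{\mathbb{R}_+}e^{-\lambda x}\,\mu(\mathrm{d}x)=\int_{\mathbb{R}_+}e^{-\lambda x}\,\mu^+(\mathrm{d}x)-\int_{\mathbb{R}_+}e^{-\lambda x}\,\mu^-(\mathrm{d}x)$, $\lambda>0$. A point $x\in\mathbb{R}_+$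 is a \emph{continuity point} of $\mu$ if $\mu(\{x\})=0$. A sequence $(\mu_n)_{n\in\mathbb{N}}$ of generalised signed Radon measures is \emph{right-equicontinuous} at $x\in\mathbb{R}_+$ if for every $\varepsilon>0$ there is $h>0$ such that $\limsup_{n\to\infty}|\mu_n((x,x+\delta])|\le\varepsilon$ for all $0\le\delta<h$. \textbf{Theorem (Continuity Theorem).} Let $\mu_n$ ($n\in\mathbb{N}$) and $\mu$ be elements of $\mathcal{M}_\Psi$ such that $\limsup_{n\to\infty}\Psi_{|\mu_n|}(\lambda)<\infty$ for every $\lambda>0$. (a) Suppose that $\Psi_{\mu_n}(\lambda)\to\Psi_\mu(\lambda)$ for all $\lambda>0$. If $(\mu_n)$ is right-equicontinuous at a continuity point $x\in\mathbb{R}_+$ of $\mu$, then $F_{\mu_n}(x)\to F_\mu(x)$. (b) If $F_{\mu_n}(x)\to F_\mu(x)$ for Lebesgue-almost every $x\in\mathbb{R}_+$, then $\Psi_{\mu_n}(\lambda)\to\Psi_\mu(\lambda)$ for all $\lambda>0$. -/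

import Mathlib

open Filter Topology MeasureTheory
open scoped NNReal ENNReal

/-- A generalised signed Radon measure on `ℝ₊ = [0, ∞)`, given by its pair `(μ⁺, μ⁻)` of mutually
singular Radon measures (locally finite, and inner regular with respect to compact sets on all
Borel sets). The extended-real-valued set function itself is `GenSignedRadonMeasure.apply`; it
determines the pair, see `GenSignedRadonMeasure.eq_of_apply_eq`. -/
structure GenSignedRadonMeasure where
  /-- the positive part `μ⁺` -/
  pos : Measure ℝ≥0
  /-- the negative part `μ⁻` -/
  neg : Measure ℝ≥0
  pos_locallyFinite : IsLocallyFiniteMeasure pos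
  neg_locallyFinite : IsLocallyFiniteMeasure neg
  pos_innerRegular : pos.InnerRegular
  neg_innerRegular : neg.InnerRegular
  mutuallySingular : pos.MutuallySingular neg

attribute [instance] GenSignedRadonMeasure.pos_locallyFinite
  GenSignedRadonMeasure.neg_locallyFinite GenSignedRadonMeasure.pos_innerRegular
  GenSignedRadonMeasure.neg_innerRegular

namespace GenSignedRadonMeasure

open scoped Classical in
/-- The value `μ(A)`: it is `μ⁺(A) - μ⁻(A)` if both are finite, and `+∞` otherwise. -/
noncomputable def apply (μ : GenSignedRadonMeasure) (A : Set ℝ≥0) : EReal :=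
  if μ.pos A < ∞ ∧ μ.neg A < ∞ then (((μ.pos A).toReal - (μ.neg A).toReal : ℝ) : EReal) else ⊤

/-- The set function of a generalised signed Radon measure determines its two parts. -/
theorem eq_of_apply_eq {μ ν : GenSignedRadonMeasure}
    (h : ∀ A, MeasurableSet A → μ.apply A = ν.apply A) : μ = ν := by
  have key : ∀ {μ ν : GenSignedRadonMeasure}, (∀ A, MeasurableSet A → μ.apply A = ν.apply A) →
      ∀ (T : ℝ≥0) (B : Set ℝ≥0), MeasurableSet B → B ⊆ Set.Icc 0 T →
        μ.pos B ≤ ν.pos B ∧ μ.neg B ≤ ν.neg B := by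
    intro μ ν h T B hB hBT
    obtain ⟨s, hs, hs0, hs1⟩ := μ.mutuallySingular
    have fin : ∀ (m : Measure ℝ≥0) [IsLocallyFiniteMeasure m] (C : Set ℝ≥0), C ⊆ B → m C < ∞ :=
      fun m _ C hC => (measure_mono (hC.trans hBT)).trans_lt isCompact_Icc.measure_lt_top
    have heq : ∀ C, MeasurableSet C → C ⊆ B → (μ.pos C).toReal - (μ.neg C).toReal
        = (ν.pos C).toReal - (ν.neg C).toReal := by
      intro C hC hCB
      have := h C hC
      rw [apply, apply, if_pos ⟨fin _ _ hCB, fin _ _ hCB⟩, if_pos ⟨fin _ _ hCB, fin _ _ hCB⟩]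
        at this
      exact_mod_cast this
    constructor
    · have h1 := heq (B \ s) (hB.diff hs) Set.sdiff_subset
      have h2 : μ.neg (B \ s) = 0 := measure_mono_null (fun x hx => hx.2) hs1
      have h3 : μ.pos B = μ.pos (B \ s) := (measure_sdiff_null hs0).symm
      rw [h2] at h1
      rw [h3]
      refine le_trans ?_ (measure_mono (Set.sdiff_subset : B \ s ⊆ B))
      rw [← ENNReal.toReal_le_toReal (fin _ _ Set.sdiff_subset).ne (fin _ _ Set.sdiff_subset).ne]
      have := ENNReal.toReal_nonneg (a := ν.neg (B \ s))
      simp only [ENNReal.toReal_zero] at h1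
      linarith
    · have h1 := heq (B ∩ s) (hB.inter hs) Set.inter_subset_left
      have h2 : μ.pos (B ∩ s) = 0 := measure_mono_null Set.inter_subset_right hs0
      have h3 : μ.neg B = μ.neg (B ∩ s) := by
        have := measure_sdiff_null (μ := μ.neg) (s := B) hs1
        rw [← this, Set.sdiff_compl]
      rw [h2] at h1
      rw [h3]
      refine le_trans ?_ (measure_mono (Set.inter_subset_left : B ∩ s ⊆ B))
      rw [← ENNReal.toReal_le_toReal (fin _ _ Set.inter_subset_left).ne
        (fin _ _ Set.inter_subset_left).ne]
      have := ENNReal.toReal_nonneg (a := ν.pos (B ∩ s))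
      simp only [ENNReal.toReal_zero] at h1
      linarith
  have ext : ∀ (m n : Measure ℝ≥0), (∀ (T : ℝ≥0) (B : Set ℝ≥0), MeasurableSet B →
      B ⊆ Set.Icc 0 T → m B = n B) → m = n := by
    intro m n hmn
    refine Measure.ext_of_iUnion_eq_univ (s := fun k : ℕ => Set.Icc (0 : ℝ≥0) k) ?_ ?_
    · refine Set.eq_univ_of_forall fun x => Set.mem_iUnion.2 ?_
      obtain ⟨k, hk⟩ := exists_nat_ge x
      exact ⟨k, bot_le, hk⟩
    · intro k
      ext A hA
      rw [Measure.restrict_apply hA, Measure.restrict_apply hA]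
      exact hmn k _ (hA.inter measurableSet_Icc) Set.inter_subset_right
  have hp : μ.pos = ν.pos := ext _ _ fun T B hB hT => le_antisymm (key h T B hB hT).1
    (key (fun A hA => (h A hA).symm) T B hB hT).1
  have hn : μ.neg = ν.neg := ext _ _ fun T B hB hT => le_antisymm (key h T B hB hT).2
    (key (fun A hA => (h A hA).symm) T B hB hT).2
  cases μ
  cases ν
  simp_all

/-- The variation `|μ| = μ⁺ + μ⁻` as a positive measure. -/
noncomputable def variation (μ : GenSignedRadonMeasure) : Measure ℝ≥0 := μ.pos + μ.neg

/-- The variation `|μ|`, viewed as a generalised signed Radon measure with zero negative part. -/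
noncomputable def abs (μ : GenSignedRadonMeasure) : GenSignedRadonMeasure where
  pos := μ.variation
  neg := 0
  pos_locallyFinite := by
    refine ⟨fun x => ?_⟩
    obtain ⟨s, hs, hs'⟩ := μ.pos.finiteAt_nhds x
    obtain ⟨t, ht, ht'⟩ := μ.neg.finiteAt_nhds x
    refine ⟨s ∩ t, inter_mem hs ht, ?_⟩
    rw [variation, Measure.add_apply]
    exact ENNReal.add_lt_top.2 ⟨(measure_mono Set.inter_subset_left).trans_lt hs',
      (measure_mono Set.inter_subset_right).trans_lt ht'⟩
  neg_locallyFinite := inferInstance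
  pos_innerRegular := by
    unfold variation
    infer_instance
  neg_innerRegular := inferInstance
  mutuallySingular := Measure.MutuallySingular.zero_right

/-- The distribution function `F_μ`: `F_μ(0) = 0` and `F_μ(x) = μ([0, x])` for `x > 0`
(a real number, since `μ⁺` and `μ⁻` are finite on compact sets). -/
noncomputable def distribution (μ : GenSignedRadonMeasure) (x : ℝ≥0) : ℝ :=
  if x = 0 then 0 else (μ.apply (Set.Icc 0 x)).toReal

/-- `μ` has a Laplace transform on all of `(0, ∞)`: `∫ e^{-λx} |μ|(dx) < ∞` for all `λ > 0`. -/
def HasLaplace (μ : GenSignedRadonMeasure) : Prop :=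
  ∀ l : ℝ, 0 < l → ∫⁻ x : ℝ≥0, ENNReal.ofReal (Real.exp (-l * x)) ∂μ.variation < ∞

/-- The Laplace transform `Ψ_μ(λ) = ∫ e^{-λx} μ(dx) = ∫ e^{-λx} μ⁺(dx) - ∫ e^{-λx} μ⁻(dx)`. -/
noncomputable def laplace (μ : GenSignedRadonMeasure) (l : ℝ) : ℝ :=
  ∫ x : ℝ≥0, Real.exp (-l * x) ∂μ.pos - ∫ x : ℝ≥0, Real.exp (-l * x) ∂μ.neg

/-- `x` is a continuity point of `μ`: `μ` does not charge `{x}`. -/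
def IsContinuityPoint (μ : GenSignedRadonMeasure) (x : ℝ≥0) : Prop := μ.apply {x} = 0

/-- Right-equicontinuity of the sequence `μ_n` at `x`: for every `ε > 0` there is `h > 0` such that
`limsup_n |μ_n((x, x + δ])| ≤ ε` for all `δ < h`. -/
def RightEquicontinuousAt (μ : ℕ → GenSignedRadonMeasure) (x : ℝ≥0) : Prop :=
  ∀ ε : ℝ≥0, 0 < ε → ∃ h : ℝ≥0, 0 < h ∧ ∀ δ : ℝ≥0, δ < h →
    limsup (fun n => ((μ n).apply (Set.Ioc x (x + δ))).abs) atTop ≤ (ε : ℝ≥0∞)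

end GenSignedRadonMeasure

/-!
The common tool is integration by parts. If `f y = ∫_{[y, ∞)} k` for a nonnegative density `k`,
then Fubini gives `∫ f dμ = ∫ k(x) μ([0, x]) dx` (`signedIntegral_eq_integral_mul_cdf`). It is used
for two densities.

*From distribution functions to Laplace transforms.* With `k(x) = λ e^{-λx}` the Laplace transform
becomes `Ψ_μ(λ) = ∫ λ e^{-λx} μ([0, x]) dx` (`HasLaplace.laplace_eq`). Chebyshev's inequality with
weight `e^{-λx/2}` bounds `|μ_n([0, x])|` by a constant times `e^{λx/2}`, uniformly in large `n`,
so dominated convergence applies (`tendsto_laplace_of_ae_tendsto_distribution`).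

*From Laplace transforms to distribution functions.* Continuous functions vanishing on some
`[T, ∞)` are approximated by polynomials in `e⁻ˣ` without constant term, with an error of at most
`ε e⁻ˣ`. As `Ψ_{|μ_n|}(1)` stays bounded, the integrals of such functions converge
(`tendsto_signedIntegral_of_tendsto_laplace`). This is applied to the trapezoid `ramp a δ`, the
tail integral of the uniform density on `(a, a + δ]`, whose integral against `μ_n` is the average of
`x ↦ μ_n([0, x])` over `(a, a + δ]` (`signedIntegral_ramp`). This average differs from
`μ_n([0, a])` by the average of `μ_n((a, x])`, which right-equicontinuity and bounded convergence
make small for large `n`, once `δ` is small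
(`RightEquicontinuousAt.eventually_signedIntegral_ramp_near`). The corresponding difference for `μ`
is small for small `δ`, because `x ↦ μ([0, x])` is right-continuous. Comparing the two averages
yields `tendsto_distribution_of_tendsto_laplace`.
-/

namespace GenSignedRadonMeasure

/-! ### Lebesgue measure on the half-line -/

/-- Lebesgue measure on `ℝ≥0`, pulled back from the real line. -/
noncomputable instance instMeasureSpaceNNReal : MeasureSpace ℝ≥0 :=
  ⟨(volume : Measure ℝ).comap ((↑) : ℝ≥0 → ℝ)⟩

lemma volume_nnreal_eq_image (A : Set ℝ≥0) :
    (volume : Measure ℝ≥0) A = (volume : Measure ℝ) (((↑) : ℝ≥0 → ℝ) '' A) :=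
  (MeasurableEmbedding.subtype_coe measurableSet_Ici).comap_apply _ _

instance instIsFiniteMeasureOnCompactsVolumeNNReal :
    IsFiniteMeasureOnCompacts (volume : Measure ℝ≥0) :=
  IsFiniteMeasureOnCompacts.comap' volume continuous_subtype_val
    (MeasurableEmbedding.subtype_coe measurableSet_Ici)

instance instNullSingletonClassVolumeNNReal : NullSingletonClass (volume : Measure ℝ≥0) :=
  ⟨fun x => by rw [volume_nnreal_eq_image, Set.image_singleton, Real.volume_singleton]⟩

/-- The volume on `ℝ≥0` integrates like Lebesgue measure on the real line. -/
lemma setLIntegral_Ici_nnreal (y : ℝ≥0) (g : ℝ → ℝ≥0∞) :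
    ∫⁻ x : ℝ≥0 in Set.Ici y, g x = ∫⁻ x : ℝ in Set.Ici (y : ℝ), g x := by
  have h := setLIntegral_subtype (μ := (volume : Measure ℝ)) (s := Set.Ici (0 : ℝ))
    measurableSet_Ici (Set.Ici y : Set ℝ≥0) g
  have himg : ((↑) : ℝ≥0 → ℝ) '' Set.Ici y = Set.Ici (y : ℝ) := by
    ext x
    constructor
    · rintro ⟨z, hz, rfl⟩
      exact NNReal.coe_le_coe.2 hz
    · intro hx
      exact ⟨⟨x, y.2.trans hx⟩, hx, rfl⟩
  rw [← himg]
  exact h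

lemma setLIntegral_Ici_exp {l : ℝ} (hl : 0 < l) (y : ℝ≥0) :
    ∫⁻ x : ℝ≥0 in Set.Ici y, ENNReal.ofReal (l * Real.exp (-l * x))
      = ENNReal.ofReal (Real.exp (-l * y)) := by
  rw [setLIntegral_Ici_nnreal y (fun x => ENNReal.ofReal (l * Real.exp (-l * x))),
    setLIntegral_congr Ioi_ae_eq_Ici.symm, ← ofReal_integral_eq_lintegral_ofReal]
  · rw [integral_const_mul, integral_exp_mul_Ioi (by linarith)]
    congr 1
    field_simp
  · exact (integrableOn_exp_mul_Ioi (by linarith) _).const_mul l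
  · exact Eventually.of_forall fun x => by positivity

/-- The trapezoidal test function: `1` on `[0, a]`, linear on `[a, a + δ]`, and `0` afterwards. -/
noncomputable def ramp (a δ y : ℝ≥0) : ℝ := min 1 (max 0 (((a : ℝ) + δ - y) / δ))

lemma ramp_nonneg (a δ y : ℝ≥0) : 0 ≤ ramp a δ y := le_min zero_le_one (le_max_left _ _)

lemma continuous_ramp (a δ : ℝ≥0) : Continuous (ramp a δ) := by
  unfold ramp
  fun_prop

lemma ramp_eq_zero {a δ y : ℝ≥0} (h : a + δ ≤ y) : ramp a δ y = 0 := by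
  have h' : (a : ℝ) + δ ≤ y := by exact_mod_cast h
  have h0 : ((a : ℝ) + δ - y) / δ ≤ 0 := div_nonpos_of_nonpos_of_nonneg (by linarith) δ.2
  rw [ramp, max_eq_left h0, min_eq_right zero_le_one]

lemma setLIntegral_Ici_ramp (a : ℝ≥0) {δ : ℝ≥0} (hδ : 0 < δ) (y : ℝ≥0) :
    ∫⁻ x : ℝ≥0 in Set.Ici y,
        ENNReal.ofReal ((Set.Ioc a (a + δ)).indicator (fun _ => (δ : ℝ)⁻¹) x)
      = ENNReal.ofReal (ramp a δ y) := by
  have hδ' : (0 : ℝ) < δ := hδ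
  have e : ∀ x : ℝ≥0, ENNReal.ofReal ((Set.Ioc a (a + δ)).indicator (fun _ => (δ : ℝ)⁻¹) x)
      = (Set.Ioc (a : ℝ) (a + δ)).indicator (fun _ => ENNReal.ofReal (δ : ℝ)⁻¹) (x : ℝ) := by
    intro x
    have hx : x ∈ Set.Ioc a (a + δ) ↔ (x : ℝ) ∈ Set.Ioc (a : ℝ) (a + δ) := by
      simp only [Set.mem_Ioc]; norm_cast
    by_cases h : x ∈ Set.Ioc a (a + δ)
    · rw [Set.indicator_of_mem h, Set.indicator_of_mem (hx.1 h)]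
    · rw [Set.indicator_of_notMem h, Set.indicator_of_notMem (fun h' => h (hx.2 h')),
        ENNReal.ofReal_zero]
  simp_rw [e]
  rw [setLIntegral_Ici_nnreal y
    ((Set.Ioc (a : ℝ) (a + δ)).indicator (fun _ => ENNReal.ofReal (δ : ℝ)⁻¹)),
    lintegral_indicator measurableSet_Ioc, lintegral_const, Measure.restrict_restrict
    measurableSet_Ioc, Measure.restrict_apply_univ]
  have hv : volume (Set.Ioc (a : ℝ) (a + δ) ∩ Set.Ici (y : ℝ))
      = ENNReal.ofReal ((a : ℝ) + δ - max (a : ℝ) (y : ℝ)) := by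
    rw [← Real.volume_Ioc, ← Set.Ioc_inter_Ioi]
    exact measure_congr ((ae_eq_refl _).inter Ioi_ae_eq_Ici.symm)
  rw [hv, ← ENNReal.ofReal_mul (by positivity), ramp]
  rcases le_total (a : ℝ) y with h | h
  · rw [max_eq_right h, min_eq_right]
    · rw [ENNReal.ofReal_max, ENNReal.ofReal_zero, max_eq_right zero_le]
      congr 1
      field_simp
    · refine max_le zero_le_one ((div_le_one hδ').2 (by linarith))
  · rw [max_eq_left h, min_eq_left]
    · congr 1
      field_simp
      ring
    · exact le_max_of_le_right ((one_le_div hδ').2 (by linarith))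

/-! ### Integration by parts -/

/-- Fubini: integrating the tail `f y = ∫_{[y, ∞)} k` of a density `k` against `m` is the same as
integrating `k` against the distribution function of `m`. -/
lemma integral_eq_integral_mul_real_Icc (m : Measure ℝ≥0) [SFinite m]
    {f k : ℝ≥0 → ℝ} (hf : Measurable f) (hk : Measurable k) (hf0 : ∀ y, 0 ≤ f y)
    (hk0 : ∀ x, 0 ≤ k x) (hm : ∀ x : ℝ≥0, m (Set.Icc 0 x) ≠ ∞)
    (hfk : ∀ y, ∫⁻ x in Set.Ici y, ENNReal.ofReal (k x) = ENNReal.ofReal (f y)) :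
    ∫ y, f y ∂m = ∫ x, k x * m.real (Set.Icc 0 x) := by
  have hmono : Monotone fun x : ℝ≥0 => m.real (Set.Icc 0 x) := fun x y hxy =>
    measureReal_mono (Set.Icc_subset_Icc_right hxy) (hm y)
  rw [integral_eq_lintegral_of_nonneg_ae (Eventually.of_forall hf0) hf.aestronglyMeasurable,
    integral_eq_lintegral_of_nonneg_ae
      (Eventually.of_forall fun x => mul_nonneg (hk0 x) measureReal_nonneg)
      (hk.mul hmono.measurable).aestronglyMeasurable]
  congr 1
  have hset : MeasurableSet {p : ℝ≥0 × ℝ≥0 | p.1 ≤ p.2} := measurableSet_le measurable_fst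
    measurable_snd
  calc ∫⁻ y, ENNReal.ofReal (f y) ∂m
      = ∫⁻ y, (∫⁻ x, {p : ℝ≥0 × ℝ≥0 | p.1 ≤ p.2}.indicator
          (fun p => ENNReal.ofReal (k p.2)) (y, x)) ∂m := by
        refine lintegral_congr fun y => ?_
        rw [← hfk y, ← lintegral_indicator measurableSet_Ici]
        rfl
    _ = ∫⁻ x, (∫⁻ y, {p : ℝ≥0 × ℝ≥0 | p.1 ≤ p.2}.indicator
          (fun p => ENNReal.ofReal (k p.2)) (y, x) ∂m) := by
        refine lintegral_lintegral_swap (Measurable.aemeasurable ?_)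
        exact (Measurable.indicator (by fun_prop) hset)
    _ = ∫⁻ x, ENNReal.ofReal (k x * m.real (Set.Icc 0 x)) := by
        refine lintegral_congr fun x => ?_
        rw [ENNReal.ofReal_mul (hk0 x), ofReal_measureReal (hm x),
          ← setLIntegral_const, ← lintegral_indicator measurableSet_Icc]
        refine lintegral_congr fun y => ?_
        simp only [Set.indicator_apply, Set.mem_ofPred_eq, Set.mem_Icc, zero_le, true_and]

/-- The integral of `f` against `μ`, as the difference of the integrals against its two parts. -/
noncomputable def signedIntegral (μ : GenSignedRadonMeasure) (f : ℝ≥0 → ℝ) : ℝ :=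
  ∫ x, f x ∂μ.pos - ∫ x, f x ∂μ.neg

/-- The right-continuous distribution function `x ↦ μ([0, x])`. It differs from `distribution`
only at `0`, where it retains the atom of `μ`. -/
noncomputable def cdf (μ : GenSignedRadonMeasure) (x : ℝ≥0) : ℝ :=
  μ.pos.real (Set.Icc 0 x) - μ.neg.real (Set.Icc 0 x)

lemma measure_Icc_ne_top (m : Measure ℝ≥0) [IsLocallyFiniteMeasure m] (x : ℝ≥0) :
    m (Set.Icc 0 x) ≠ ∞ := isCompact_Icc.measure_lt_top.ne

lemma monotone_real_Icc (m : Measure ℝ≥0) [IsLocallyFiniteMeasure m] :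
    Monotone fun x : ℝ≥0 => m.real (Set.Icc 0 x) := fun _ y hxy =>
  measureReal_mono (Set.Icc_subset_Icc_right hxy) (measure_Icc_ne_top m y)

lemma measurable_cdf (μ : GenSignedRadonMeasure) : Measurable μ.cdf :=
  (monotone_real_Icc μ.pos).measurable.sub (monotone_real_Icc μ.neg).measurable

lemma apply_eq_coe (μ : GenSignedRadonMeasure) {A : Set ℝ≥0} {x : ℝ≥0} (hA : A ⊆ Set.Icc 0 x) :
    μ.apply A = ((μ.pos.real A - μ.neg.real A : ℝ) : EReal) := by
  rw [apply, if_pos]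
  · rfl
  · exact ⟨(measure_mono hA).trans_lt (measure_Icc_ne_top _ _).lt_top,
      (measure_mono hA).trans_lt (measure_Icc_ne_top _ _).lt_top⟩

lemma distribution_eq_cdf (μ : GenSignedRadonMeasure) {x : ℝ≥0} (hx : x ≠ 0) :
    μ.distribution x = μ.cdf x := by
  rw [distribution, if_neg hx, μ.apply_eq_coe subset_rfl, EReal.toReal_coe, cdf]

lemma apply_Ioc (μ : GenSignedRadonMeasure) {a x : ℝ≥0} (h : a ≤ x) :
    μ.apply (Set.Ioc a x) = ((μ.cdf x - μ.cdf a : ℝ) : EReal) := by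
  have key : ∀ (m : Measure ℝ≥0) [IsLocallyFiniteMeasure m],
      m.real (Set.Ioc a x) = m.real (Set.Icc 0 x) - m.real (Set.Icc 0 a) := by
    intro m _
    rw [← measureReal_sdiff (Set.Icc_subset_Icc_right h) measurableSet_Icc
      (measure_Icc_ne_top m x)]
    congr 1
    ext y
    simp [and_comm]
  rw [μ.apply_eq_coe (x := x) (fun y hy => ⟨bot_le, hy.2⟩), key, key, cdf, cdf]
  congr 1
  ring

lemma signedIntegral_eq_integral_mul_cdf (μ : GenSignedRadonMeasure) {f k : ℝ≥0 → ℝ}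
    (hf : Measurable f) (hk : Measurable k) (hf0 : ∀ y, 0 ≤ f y) (hk0 : ∀ x, 0 ≤ k x)
    (hfk : ∀ y, ∫⁻ x in Set.Ici y, ENNReal.ofReal (k x) = ENNReal.ofReal (f y))
    (hpos : Integrable fun x : ℝ≥0 => k x * μ.pos.real (Set.Icc 0 x))
    (hneg : Integrable fun x : ℝ≥0 => k x * μ.neg.real (Set.Icc 0 x)) :
    μ.signedIntegral f = ∫ x, k x * μ.cdf x := by
  rw [signedIntegral,
    integral_eq_integral_mul_real_Icc μ.pos hf hk hf0 hk0 (measure_Icc_ne_top _) hfk,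
    integral_eq_integral_mul_real_Icc μ.neg hf hk hf0 hk0 (measure_Icc_ne_top _) hfk,
    ← integral_sub hpos hneg]
  simp only [cdf, mul_sub]

/-! ### Bounds by the Laplace transform of the variation -/

lemma HasLaplace.integrable_pos {μ : GenSignedRadonMeasure} (h : μ.HasLaplace) {l : ℝ}
    (hl : 0 < l) : Integrable (fun x : ℝ≥0 => Real.exp (-l * x)) μ.pos := by
  refine ⟨by fun_prop, ?_⟩
  rw [hasFiniteIntegral_iff_ofReal (Eventually.of_forall fun x => (Real.exp_pos _).le)]
  exact (lintegral_mono' (Measure.le_add_right le_rfl) le_rfl).trans_lt (h l hl)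

lemma HasLaplace.integrable_neg {μ : GenSignedRadonMeasure} (h : μ.HasLaplace) {l : ℝ}
    (hl : 0 < l) : Integrable (fun x : ℝ≥0 => Real.exp (-l * x)) μ.neg := by
  refine ⟨by fun_prop, ?_⟩
  rw [hasFiniteIntegral_iff_ofReal (Eventually.of_forall fun x => (Real.exp_pos _).le)]
  exact (lintegral_mono' (Measure.le_add_left le_rfl) le_rfl).trans_lt (h l hl)

lemma HasLaplace.abs_laplace {μ : GenSignedRadonMeasure} (h : μ.HasLaplace) {l : ℝ}
    (hl : 0 < l) : μ.abs.laplace l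
      = ∫ x : ℝ≥0, Real.exp (-l * x) ∂μ.pos + ∫ x : ℝ≥0, Real.exp (-l * x) ∂μ.neg := by
  have hneg : μ.abs.neg = 0 := rfl
  have hpos : μ.abs.pos = μ.pos + μ.neg := rfl
  rw [laplace, hneg, hpos, integral_add_measure (h.integrable_pos hl) (h.integrable_neg hl),
    integral_zero_measure, sub_zero]

/-- Chebyshev's inequality for the exponential weight. -/
lemma real_Icc_le (m : Measure ℝ≥0) [IsLocallyFiniteMeasure m] {l : ℝ} (hl : 0 < l)
    (hm : Integrable (fun x : ℝ≥0 => Real.exp (-l * x)) m) (x : ℝ≥0) :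
    m.real (Set.Icc 0 x) ≤ Real.exp (l * x) * ∫ y : ℝ≥0, Real.exp (-l * y) ∂m := by
  have h1 : Real.exp (-l * x) * m.real (Set.Icc 0 x) ≤ ∫ y : ℝ≥0, Real.exp (-l * y) ∂m := by
    calc Real.exp (-l * x) * m.real (Set.Icc 0 x)
        ≤ ∫ y : ℝ≥0 in Set.Icc 0 x, Real.exp (-l * y) ∂m := by
          refine setIntegral_ge_of_const_le_real measurableSet_Icc (measure_Icc_ne_top m x)
            (fun y hy => Real.exp_le_exp.2 ?_) hm.integrableOn
          have : (y : ℝ) ≤ x := hy.2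
          nlinarith
      _ ≤ _ := setIntegral_le_integral hm (Eventually.of_forall fun y => (Real.exp_pos _).le)
  calc m.real (Set.Icc 0 x)
      = Real.exp (l * x) * (Real.exp (-l * x) * m.real (Set.Icc 0 x)) := by
        rw [← mul_assoc, ← Real.exp_add]; simp
    _ ≤ _ := by gcongr

lemma HasLaplace.real_Icc_add_le {μ : GenSignedRadonMeasure} (h : μ.HasLaplace) {l : ℝ}
    (hl : 0 < l) (x : ℝ≥0) :
    μ.pos.real (Set.Icc 0 x) + μ.neg.real (Set.Icc 0 x) ≤ Real.exp (l * x) * μ.abs.laplace l := by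
  rw [h.abs_laplace hl, mul_add]
  exact add_le_add (real_Icc_le _ hl (h.integrable_pos hl) x)
    (real_Icc_le _ hl (h.integrable_neg hl) x)

lemma HasLaplace.abs_cdf_le {μ : GenSignedRadonMeasure} (h : μ.HasLaplace) {l : ℝ}
    (hl : 0 < l) (x : ℝ≥0) : |μ.cdf x| ≤ Real.exp (l * x) * μ.abs.laplace l := by
  refine le_trans ?_ (h.real_Icc_add_le hl x)
  have h1 : 0 ≤ μ.pos.real (Set.Icc 0 x) := measureReal_nonneg
  have h2 : 0 ≤ μ.neg.real (Set.Icc 0 x) := measureReal_nonneg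
  rw [cdf, abs_le]
  constructor <;> linarith

/-! ### The two integral representations -/

lemma integrable_exp_nnreal {l : ℝ} (hl : 0 < l) :
    Integrable fun x : ℝ≥0 => Real.exp (-l * x) := by
  refine ⟨by fun_prop, ?_⟩
  rw [hasFiniteIntegral_iff_ofReal (Eventually.of_forall fun x => (Real.exp_pos _).le)]
  have h := setLIntegral_Ici_exp hl 0
  have h0 : Set.Ici (0 : ℝ≥0) = Set.univ := Set.Ici_bot
  rw [h0, setLIntegral_univ] at h
  simp_rw [ENNReal.ofReal_mul hl.le] at h
  rw [lintegral_const_mul _ (by fun_prop)] at h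
  by_contra hc
  rw [not_lt, top_le_iff] at hc
  rw [hc, ENNReal.mul_top (by simpa using hl)] at h
  exact ENNReal.ofReal_ne_top h.symm

lemma HasLaplace.laplace_eq {μ : GenSignedRadonMeasure} (h : μ.HasLaplace) {l : ℝ} (hl : 0 < l) :
    μ.laplace l = ∫ x : ℝ≥0, l * Real.exp (-l * x) * μ.cdf x := by
  have hint : ∀ (m : Measure ℝ≥0) [IsLocallyFiniteMeasure m],
      (∀ x, m.real (Set.Icc 0 x) ≤ Real.exp (l / 2 * x) * μ.abs.laplace (l / 2)) →
      Integrable fun x : ℝ≥0 => l * Real.exp (-l * x) * m.real (Set.Icc 0 x) := by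
    intro m _ hm
    refine Integrable.mono' ((integrable_exp_nnreal (half_pos hl)).const_mul
      (l * μ.abs.laplace (l / 2))) ?_ (Eventually.of_forall fun x => ?_)
    · have := (monotone_real_Icc m).measurable
      exact Measurable.aestronglyMeasurable (by fun_prop)
    · have h0 : 0 ≤ m.real (Set.Icc 0 x) := measureReal_nonneg
      rw [Real.norm_of_nonneg (by positivity)]
      calc l * Real.exp (-l * x) * m.real (Set.Icc 0 x)
          ≤ l * Real.exp (-l * x) * (Real.exp (l / 2 * x) * μ.abs.laplace (l / 2)) := by
            gcongr; exact hm x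
        _ = l * μ.abs.laplace (l / 2) * (Real.exp (-l * x) * Real.exp (l / 2 * x)) := by ring
        _ = _ := by rw [← Real.exp_add]; congr 2; ring
  refine μ.signedIntegral_eq_integral_mul_cdf (f := fun x : ℝ≥0 => Real.exp (-l * x))
    (by fun_prop) (by fun_prop) (fun y => (Real.exp_pos _).le) (fun x => by positivity)
    (setLIntegral_Ici_exp hl) (hint _ fun x => ?_) (hint _ fun x => ?_)
  · exact (le_add_of_nonneg_right measureReal_nonneg).trans (h.real_Icc_add_le (half_pos hl) x)
  · exact (le_add_of_nonneg_left measureReal_nonneg).trans (h.real_Icc_add_le (half_pos hl) x)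

lemma volume_Ioc_nnreal (a δ : ℝ≥0) : (volume : Measure ℝ≥0) (Set.Ioc a (a + δ)) = δ := by
  have himg : ((↑) : ℝ≥0 → ℝ) '' Set.Ioc a (a + δ) = Set.Ioc (a : ℝ) (a + δ) := by
    ext x
    constructor
    · rintro ⟨z, hz, rfl⟩
      exact ⟨hz.1, hz.2⟩
    · intro hx
      exact ⟨⟨x, a.2.trans hx.1.le⟩, ⟨hx.1, hx.2⟩, rfl⟩
  rw [volume_nnreal_eq_image, himg, Real.volume_Ioc]
  simp

lemma integrableOn_real_Icc (m : Measure ℝ≥0) [IsLocallyFiniteMeasure m] (a δ : ℝ≥0) :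
    IntegrableOn (fun x : ℝ≥0 => m.real (Set.Icc 0 x)) (Set.Ioc a (a + δ)) := by
  refine Measure.integrableOn_of_bounded (M := m.real (Set.Icc 0 (a + δ)))
    (by rw [volume_Ioc_nnreal]; simp)
    (monotone_real_Icc m).measurable.aestronglyMeasurable ?_
  refine (ae_restrict_mem measurableSet_Ioc).mono fun x hx => ?_
  rw [Real.norm_of_nonneg measureReal_nonneg]
  exact monotone_real_Icc m hx.2

lemma integrableOn_cdf (μ : GenSignedRadonMeasure) (a δ : ℝ≥0) :
    IntegrableOn μ.cdf (Set.Ioc a (a + δ)) :=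
  (integrableOn_real_Icc μ.pos a δ).sub (integrableOn_real_Icc μ.neg a δ)

/-- Integrating the trapezoid averages the distribution function over `(a, a + δ]`. -/
lemma signedIntegral_ramp (μ : GenSignedRadonMeasure) (a : ℝ≥0) {δ : ℝ≥0} (hδ : 0 < δ) :
    μ.signedIntegral (ramp a δ) = (δ : ℝ)⁻¹ * ∫ x in Set.Ioc a (a + δ), μ.cdf x := by
  have e : ∀ (g : ℝ≥0 → ℝ), (fun x => (Set.Ioc a (a + δ)).indicator (fun _ => (δ : ℝ)⁻¹) x * g x)
      = (Set.Ioc a (a + δ)).indicator fun x => (δ : ℝ)⁻¹ * g x := by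
    intro g
    ext x
    by_cases h : x ∈ Set.Ioc a (a + δ) <;> simp [h]
  have hint : ∀ (m : Measure ℝ≥0) [IsLocallyFiniteMeasure m],
      Integrable fun x => (Set.Ioc a (a + δ)).indicator (fun _ => (δ : ℝ)⁻¹) x
        * m.real (Set.Icc 0 x) := by
    intro m _
    rw [e, integrable_indicator_iff measurableSet_Ioc]
    exact (integrableOn_real_Icc m a δ).const_mul _
  rw [μ.signedIntegral_eq_integral_mul_cdf (continuous_ramp a δ).measurable
    (measurable_const.indicator measurableSet_Ioc) (ramp_nonneg a δ)
    (fun x => Set.indicator_nonneg (fun _ _ => by positivity) x) (setLIntegral_Ici_ramp a hδ)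
    (hint _) (hint _), e, integral_indicator measurableSet_Ioc, integral_const_mul]

/-! ### From distribution functions to Laplace transforms -/

lemma eventually_abs_laplace_le {μn : ℕ → GenSignedRadonMeasure} {l : ℝ}
    (h : limsup (fun n => (((μn n).abs.laplace l : ℝ) : EReal)) atTop < ⊤) :
    ∃ C : ℝ, 0 ≤ C ∧ ∀ᶠ n in atTop, (μn n).abs.laplace l ≤ C := by
  obtain ⟨C, hC, -⟩ := EReal.lt_iff_exists_real_btwn.1 h
  refine ⟨max 0 C, le_max_left _ _, (eventually_lt_of_limsup_lt hC).mono fun n hn => ?_⟩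
  exact le_max_of_le_right (EReal.coe_lt_coe_iff.1 hn).le

theorem tendsto_laplace_of_ae_tendsto_distribution {μn : ℕ → GenSignedRadonMeasure}
    {μ : GenSignedRadonMeasure} (hμn : ∀ n, (μn n).HasLaplace) (hμ : μ.HasLaplace)
    (hbdd : ∀ l : ℝ, 0 < l → limsup (fun n => (((μn n).abs.laplace l : ℝ) : EReal)) atTop < ⊤)
    (hF : ∀ᵐ x : ℝ≥0, Tendsto (fun n => (μn n).distribution x) atTop (𝓝 (μ.distribution x)))
    {l : ℝ} (hl : 0 < l) :
    Tendsto (fun n => (μn n).laplace l) atTop (𝓝 (μ.laplace l)) := by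
  obtain ⟨C, -, hC⟩ := eventually_abs_laplace_le (hbdd (l / 2) (half_pos hl))
  rw [hμ.laplace_eq hl]
  simp_rw [fun n => (hμn n).laplace_eq hl]
  refine tendsto_integral_filter_of_dominated_convergence
    (fun x : ℝ≥0 => l * C * Real.exp (-(l / 2) * x)) (Eventually.of_forall fun n => ?_)
    (hC.mono fun n hn => Eventually.of_forall fun x => ?_)
    ((integrable_exp_nnreal (half_pos hl)).const_mul _) ?_
  · have := (μn n).measurable_cdf
    exact Measurable.aestronglyMeasurable (by fun_prop)
  · rw [norm_mul, Real.norm_of_nonneg (by positivity), Real.norm_eq_abs]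
    calc l * Real.exp (-l * x) * |(μn n).cdf x|
        ≤ l * Real.exp (-l * x) * (Real.exp (l / 2 * x) * C) := by
          gcongr
          exact ((hμn n).abs_cdf_le (half_pos hl) x).trans (by gcongr)
      _ = l * C * (Real.exp (-l * x) * Real.exp (l / 2 * x)) := by ring
      _ = _ := by rw [← Real.exp_add]; congr 2; ring
  · filter_upwards [hF, measure_eq_zero_iff_ae_notMem.1 (measure_singleton (μ := volume) (0 : ℝ≥0))]
      with x hx hx0
    simp_rw [fun ν : GenSignedRadonMeasure => ν.distribution_eq_cdf hx0] at hx
    exact hx.const_mul _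

/-! ### From Laplace transforms to compactly supported test functions -/

/-- Weierstrass approximation in the variable `e⁻ˣ`. Dividing by `e⁻ˣ` before approximating leaves
only the exponentials `e^{-(k+1)x}` with positive rates, and makes the error proportional to
`e⁻ˣ`. -/
lemma exists_polynomial_exp_near {f : ℝ≥0 → ℝ} (hf : Continuous f) {T : ℝ≥0}
    (hT : ∀ x, T ≤ x → f x = 0) {ε : ℝ} (hε : 0 < ε) :
    ∃ p : Polynomial ℝ, ∀ x : ℝ≥0,
      |f x - Real.exp (-x) * p.eval (Real.exp (-x))| ≤ ε * Real.exp (-x) := by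
  -- For `x ≤ T` this function sends `e⁻ˣ` to `eˣ f x`; truncating the logarithm at
  -- `e⁻ᵀ` keeps it continuous at `0`.
  let g : ℝ → ℝ := fun u => (max u (Real.exp (-T)))⁻¹ *
    f (-Real.log (max u (Real.exp (-T)))).toNNReal
  have hpos : ∀ u : ℝ, 0 < max u (Real.exp (-T)) := fun u => lt_max_of_lt_right (Real.exp_pos _)
  have hg : Continuous g := by
    have h1 : Continuous fun u : ℝ => max u (Real.exp (-T)) := by fun_prop
    exact (h1.inv₀ fun u => (hpos u).ne').mul
      (hf.comp (continuous_real_toNNReal.comp (h1.log fun u => (hpos u).ne').neg))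
  obtain ⟨p, hp⟩ := exists_polynomial_near_of_continuousOn 0 1 g hg.continuousOn ε hε
  refine ⟨p, fun x => ?_⟩
  have hgx : Real.exp (-x) * g (Real.exp (-x)) = f x := by
    rcases le_total x T with h | h
    · have h' : Real.exp (-T) ≤ Real.exp (-x) := Real.exp_le_exp.2 (neg_le_neg h)
      simp only [g, max_eq_left h', Real.log_exp, neg_neg, Real.toNNReal_coe]
      rw [mul_inv_cancel_left₀ (Real.exp_pos _).ne']
    · have h' : Real.exp (-x) ≤ Real.exp (-T) := Real.exp_le_exp.2 (neg_le_neg h)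
      simp only [g, max_eq_right h', Real.log_exp, neg_neg, Real.toNNReal_coe]
      rw [hT T le_rfl, hT x h, mul_zero, mul_zero]
  have h := hp (Real.exp (-x)) ⟨(Real.exp_pos _).le, Real.exp_le_one_iff.2 (neg_nonpos.2 x.2)⟩
  rw [← hgx, ← mul_sub, abs_mul, abs_of_pos (Real.exp_pos _), mul_comm ε, abs_sub_comm]
  exact mul_le_mul_of_nonneg_left h.le (Real.exp_pos _).le

lemma exp_mul_eval_exp (p : Polynomial ℝ) (x : ℝ≥0) :
    Real.exp (-x) * p.eval (Real.exp (-x))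
      = ∑ k ∈ Finset.range (p.natDegree + 1), p.coeff k * Real.exp (-((k : ℝ) + 1) * x) := by
  rw [Polynomial.eval_eq_sum_range, Finset.mul_sum]
  refine Finset.sum_congr rfl fun k _ => ?_
  rw [mul_left_comm, ← Real.exp_nat_mul, ← Real.exp_add]
  congr 2
  ring

lemma HasLaplace.signedIntegral_exp_mul_eval {μ : GenSignedRadonMeasure} (h : μ.HasLaplace)
    (p : Polynomial ℝ) :
    μ.signedIntegral (fun x => Real.exp (-x) * p.eval (Real.exp (-x)))
      = ∑ k ∈ Finset.range (p.natDegree + 1), p.coeff k * μ.laplace ((k : ℝ) + 1) := by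
  simp_rw [signedIntegral, exp_mul_eval_exp]
  rw [integral_finsetSum _ fun k _ => (h.integrable_pos (by positivity)).const_mul _,
    integral_finsetSum _ fun k _ => (h.integrable_neg (by positivity)).const_mul _,
    ← Finset.sum_sub_distrib]
  refine Finset.sum_congr rfl fun k _ => ?_
  rw [integral_const_mul, integral_const_mul, ← mul_sub, laplace]

lemma HasLaplace.abs_signedIntegral_sub_le {μ : GenSignedRadonMeasure} (h : μ.HasLaplace)
    {f : ℝ≥0 → ℝ} (hf : Continuous f) (hfc : HasCompactSupport f) (p : Polynomial ℝ) {ε : ℝ}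
    (hp : ∀ x : ℝ≥0, |f x - Real.exp (-x) * p.eval (Real.exp (-x))| ≤ ε * Real.exp (-x)) :
    |μ.signedIntegral f - μ.signedIntegral (fun x => Real.exp (-x) * p.eval (Real.exp (-x)))|
      ≤ ε * μ.abs.laplace 1 := by
  have key : ∀ (m : Measure ℝ≥0) [IsLocallyFiniteMeasure m],
      (∀ l : ℝ, 0 < l → Integrable (fun x : ℝ≥0 => Real.exp (-l * x)) m) →
      |∫ x, f x ∂m - ∫ x : ℝ≥0, Real.exp (-x) * p.eval (Real.exp (-x)) ∂m|
        ≤ ε * ∫ x : ℝ≥0, Real.exp (-1 * x) ∂m := by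
    intro m _ hm
    have hpi : Integrable (fun x : ℝ≥0 => Real.exp (-x) * p.eval (Real.exp (-x))) m := by
      simp_rw [exp_mul_eval_exp]
      exact integrable_finsetSum _ fun k _ => (hm _ (by positivity)).const_mul _
    rw [← integral_sub (hf.integrable_of_hasCompactSupport hfc) hpi, ← integral_const_mul,
      ← Real.norm_eq_abs]
    refine norm_integral_le_of_norm_le ((hm 1 one_pos).const_mul ε)
      (Eventually.of_forall fun x => ?_)
    rw [neg_one_mul]
    exact hp x
  have h1 := key μ.pos fun l hl => h.integrable_pos hl
  have h2 := key μ.neg fun l hl => h.integrable_neg hl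
  rw [h.abs_laplace one_pos, signedIntegral, signedIntegral, sub_sub_sub_comm, mul_add]
  exact (abs_sub _ _).trans (add_le_add h1 h2)

/-- Convergence of the Laplace transforms implies vague convergence. -/
theorem tendsto_signedIntegral_of_tendsto_laplace {μn : ℕ → GenSignedRadonMeasure}
    {μ : GenSignedRadonMeasure} (hμn : ∀ n, (μn n).HasLaplace) (hμ : μ.HasLaplace)
    (hbdd : limsup (fun n => (((μn n).abs.laplace 1 : ℝ) : EReal)) atTop < ⊤)
    (hΨ : ∀ l : ℝ, 0 < l → Tendsto (fun n => (μn n).laplace l) atTop (𝓝 (μ.laplace l)))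
    {f : ℝ≥0 → ℝ} (hf : Continuous f) {T : ℝ≥0} (hT : ∀ x, T ≤ x → f x = 0) :
    Tendsto (fun n => (μn n).signedIntegral f) atTop (𝓝 (μ.signedIntegral f)) := by
  have hfc : HasCompactSupport f := by
    refine HasCompactSupport.intro (K := Set.Icc 0 T) isCompact_Icc fun x hx => hT x ?_
    by_contra h
    exact hx ⟨zero_le, (not_le.1 h).le⟩
  obtain ⟨C, hC0, hC⟩ := eventually_abs_laplace_le hbdd
  rw [Metric.tendsto_atTop']
  intro ε hε
  set D := max C (μ.abs.laplace 1) with hD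
  have hD0 : 0 ≤ D := le_max_of_le_left hC0
  set η := ε / (3 * (D + 1)) with hη
  have hη0 : 0 < η := by positivity
  have hηD : η * D < ε / 3 := by
    rw [hη, div_mul_eq_mul_div, div_lt_div_iff₀ (by positivity) (by positivity)]
    nlinarith
  obtain ⟨p, hp⟩ := exists_polynomial_exp_near hf hT hη0
  have hlim : Tendsto
      (fun n => (μn n).signedIntegral fun x => Real.exp (-x) * p.eval (Real.exp (-x))) atTop
      (𝓝 (μ.signedIntegral fun x => Real.exp (-x) * p.eval (Real.exp (-x)))) := by
    rw [hμ.signedIntegral_exp_mul_eval]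
    simp_rw [fun n => (hμn n).signedIntegral_exp_mul_eval]
    exact tendsto_finsetSum _ fun k _ => (hΨ _ (by positivity)).const_mul _
  have hev := (Metric.tendsto_nhds.1 hlim (ε / 3) (by positivity)).and hC
  obtain ⟨N, hN⟩ := eventually_atTop.1 hev
  refine ⟨N, fun n hn => ?_⟩
  obtain ⟨h1, h2⟩ := hN n hn.le
  have h3 := (hμn n).abs_signedIntegral_sub_le hf hfc p hp
  have h4 := hμ.abs_signedIntegral_sub_le hf hfc p hp
  have h5 : η * (μn n).abs.laplace 1 ≤ η * D :=
    mul_le_mul_of_nonneg_left (h2.trans (le_max_left _ _)) hη0.le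
  have h6 : η * μ.abs.laplace 1 ≤ η * D := mul_le_mul_of_nonneg_left (le_max_right _ _) hη0.le
  rw [Real.dist_eq] at h1 ⊢
  rw [abs_lt] at h1 ⊢
  rw [abs_le] at h3 h4
  constructor <;> linarith [h1.1, h1.2, h3.1, h3.2, h4.1, h4.2]

/-! ### From test functions to distribution functions -/

/-- Averages of uniformly bounded functions whose values are eventually at most `ε` pointwise
are eventually at most `2 ε`. -/
lemma eventually_abs_average_le {a δ : ℝ≥0} (hδ : 0 < δ) {g : ℕ → ℝ≥0 → ℝ}
    (hg : ∀ n, Measurable (g n)) {C : ℝ} (hC : ∀ᶠ n in atTop, ∀ x ∈ Set.Ioc a (a + δ), |g n x| ≤ C)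
    {ε : ℝ} (hε : 0 < ε) (hgε : ∀ x ∈ Set.Ioc a (a + δ), ∀ᶠ n in atTop, |g n x| ≤ ε) :
    ∀ᶠ n in atTop, |(δ : ℝ)⁻¹ * ∫ x in Set.Ioc a (a + δ), g n x| ≤ 2 * ε := by
  have hδ' : (0 : ℝ) < δ := hδ
  have hfin : IsFiniteMeasure ((volume : Measure ℝ≥0).restrict (Set.Ioc a (a + δ))) :=
    ⟨by rw [Measure.restrict_apply_univ, volume_Ioc_nnreal]; exact ENNReal.coe_lt_top⟩
  have hvol : ((volume : Measure ℝ≥0).restrict (Set.Ioc a (a + δ))).real Set.univ = δ := by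
    rw [measureReal_restrict_apply_univ, Measure.real, volume_Ioc_nnreal, ENNReal.coe_toReal]
  have hmeas : ∀ n, Measurable fun x => max (|g n x| - ε) 0 := fun n =>
    (((hg n).abs.sub_const ε).max measurable_const)
  have hbd : ∀ᶠ n in atTop, ∀ᵐ x ∂(volume : Measure ℝ≥0).restrict (Set.Ioc a (a + δ)),
      ‖max (|g n x| - ε) 0‖ ≤ C := by
    filter_upwards [hC] with n hn
    filter_upwards [ae_restrict_mem measurableSet_Ioc] with x hx
    rw [Real.norm_of_nonneg (le_max_right _ _)]
    have := hn x hx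
    exact max_le (by linarith) ((abs_nonneg _).trans this)
  -- Only the excess of `|g n|` over `ε` matters, and it tends to `0` pointwise and boundedly.
  have hlim : Tendsto (fun n => ∫ x in Set.Ioc a (a + δ), max (|g n x| - ε) 0) atTop
      (𝓝 (∫ x in Set.Ioc a (a + δ), (0 : ℝ))) := by
    refine tendsto_integral_filter_of_dominated_convergence (fun _ => C)
      (Eventually.of_forall fun n => (hmeas n).aestronglyMeasurable) hbd
      (integrable_const C) ?_
    filter_upwards [ae_restrict_mem measurableSet_Ioc] with x hx
    refine tendsto_const_nhds.congr' ?_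
    filter_upwards [hgε x hx] with n hn
    rw [max_eq_right (by linarith)]
  rw [integral_zero] at hlim
  filter_upwards [hlim.eventually (gt_mem_nhds (mul_pos hδ' hε)), hbd] with n hn hb
  have hint : Integrable (fun x => max (|g n x| - ε) 0)
      ((volume : Measure ℝ≥0).restrict (Set.Ioc a (a + δ))) :=
    (integrable_const C).mono' (hmeas n).aestronglyMeasurable hb
  have hle : |∫ x in Set.Ioc a (a + δ), g n x| ≤ 2 * ε * δ := by
    rw [← Real.norm_eq_abs]
    refine (norm_integral_le_of_norm_le (hint.add (integrable_const ε))
      (Eventually.of_forall fun x => ?_)).trans ?_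
    · rw [Real.norm_eq_abs]
      have := le_max_left (|g n x| - ε) 0
      simp only [Pi.add_apply]
      linarith
    · simp only [Pi.add_apply]
      rw [integral_add hint (integrable_const ε), integral_const, hvol, smul_eq_mul]
      linarith
  rw [abs_mul, abs_of_pos (inv_pos.2 hδ'), inv_mul_le_iff₀ hδ']
  linarith

lemma signedIntegral_ramp_sub_cdf (μ : GenSignedRadonMeasure) (a : ℝ≥0) {δ : ℝ≥0} (hδ : 0 < δ) :
    μ.signedIntegral (ramp a δ) - μ.cdf a
      = (δ : ℝ)⁻¹ * ∫ x in Set.Ioc a (a + δ), (μ.cdf x - μ.cdf a) := by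
  have hδ' : (δ : ℝ) ≠ 0 := NNReal.coe_ne_zero.2 hδ.ne'
  have hfin : IsFiniteMeasure ((volume : Measure ℝ≥0).restrict (Set.Ioc a (a + δ))) :=
    ⟨by rw [Measure.restrict_apply_univ, volume_Ioc_nnreal]; exact ENNReal.coe_lt_top⟩
  have hvol : ((volume : Measure ℝ≥0).restrict (Set.Ioc a (a + δ))).real Set.univ = δ := by
    rw [measureReal_restrict_apply_univ, Measure.real, volume_Ioc_nnreal, ENNReal.coe_toReal]
  rw [signedIntegral_ramp μ a hδ, integral_sub (integrableOn_cdf μ a δ) (integrable_const _),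
    integral_const, hvol, smul_eq_mul]
  field_simp

lemma tendsto_cdf_nhdsGT (μ : GenSignedRadonMeasure) (a : ℝ≥0) :
    Tendsto μ.cdf (𝓝[>] a) (𝓝 (μ.cdf a)) := by
  have key : ∀ (m : Measure ℝ≥0) [IsLocallyFiniteMeasure m],
      Tendsto (fun x => m.real (Set.Icc 0 x)) (𝓝[>] a) (𝓝 (m.real (Set.Icc 0 a))) := by
    intro m _
    have h := tendsto_measure_biInter_gt (μ := m) (s := fun x : ℝ≥0 => Set.Icc 0 x) (a := a)
      (fun r _ => measurableSet_Icc.nullMeasurableSet)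
      (fun i j _ hij => Set.Icc_subset_Icc_right hij) ⟨a + 1, by simp, measure_Icc_ne_top m _⟩
    have hI : (⋂ r > a, Set.Icc 0 r) = Set.Icc 0 a := by
      ext y
      simp only [Set.mem_iInter, Set.mem_Icc, zero_le, true_and]
      exact ⟨fun hy => le_of_forall_gt_imp_ge_of_dense hy, fun hy r hr => hy.trans (le_of_lt hr)⟩
    rw [hI] at h
    exact (ENNReal.tendsto_toReal (measure_Icc_ne_top m a)).comp h
  exact (key μ.pos).sub (key μ.neg)

/-- Right-equicontinuity keeps the distribution functions close to their averages over a short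
interval to the right. -/
lemma RightEquicontinuousAt.eventually_signedIntegral_ramp_near
    {μn : ℕ → GenSignedRadonMeasure} {a : ℝ≥0} (h : RightEquicontinuousAt μn a)
    (hμn : ∀ n, (μn n).HasLaplace)
    (hbdd : limsup (fun n => (((μn n).abs.laplace 1 : ℝ) : EReal)) atTop < ⊤)
    {ε : ℝ} (hε : 0 < ε) :
    ∃ r : ℝ≥0, 0 < r ∧ ∀ δ : ℝ≥0, 0 < δ → δ < r →
      ∀ᶠ n in atTop, |(μn n).signedIntegral (ramp a δ) - (μn n).cdf a| ≤ ε := by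
  obtain ⟨C, hC0, hC⟩ := eventually_abs_laplace_le hbdd
  obtain ⟨r, hr, hlim⟩ := h (ε / 4).toNNReal (by simpa using hε)
  refine ⟨r, hr, fun δ hδ hδr => ?_⟩
  simp_rw [fun n => (μn n).signedIntegral_ramp_sub_cdf a hδ]
  have hmain := eventually_abs_average_le (a := a) (g := fun n x => (μn n).cdf x - (μn n).cdf a) hδ
    (fun n => (μn n).measurable_cdf.sub_const _)
    (C := 2 * (Real.exp (a + δ) * C)) (ε := ε / 2) ?_ (half_pos hε) ?_
  · filter_upwards [hmain] with n hn
    linarith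
  · filter_upwards [hC] with n hn x hx
    have hb : ∀ y : ℝ≥0, y ≤ a + δ → |(μn n).cdf y| ≤ Real.exp (a + δ) * C := by
      intro y hy
      have hy' : (y : ℝ) ≤ a + δ := by exact_mod_cast hy
      refine ((hμn n).abs_cdf_le one_pos y).trans ?_
      rw [one_mul]
      exact (mul_le_mul_of_nonneg_left hn (Real.exp_pos _).le).trans
        (mul_le_mul_of_nonneg_right (Real.exp_le_exp.2 hy') hC0)
    have h1 := hb x hx.2
    have h2 := hb a le_self_add
    exact (abs_sub _ _).trans (by linarith)
  · intro x hx
    obtain ⟨d, rfl⟩ := exists_add_of_le hx.1.le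
    have hd : d < r := lt_of_le_of_lt (by simpa using hx.2) hδr
    have hlt : limsup (fun n => ((μn n).apply (Set.Ioc a (a + d))).abs) atTop
        < ENNReal.ofReal (ε / 2) :=
      (hlim d hd).trans_lt ((ENNReal.ofReal_lt_ofReal_iff (half_pos hε)).2 (by linarith))
    filter_upwards [eventually_lt_of_limsup_lt hlt] with n hn
    rw [apply_Ioc _ hx.1.le, EReal.abs_def] at hn
    exact ((ENNReal.ofReal_lt_ofReal_iff (half_pos hε)).1 hn).le

lemma eventually_abs_signedIntegral_ramp_sub_cdf_le (μ : GenSignedRadonMeasure) (a : ℝ≥0) {ε : ℝ}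
    (hε : 0 < ε) :
    ∀ᶠ δ in 𝓝[>] (0 : ℝ≥0), |μ.signedIntegral (ramp a δ) - μ.cdf a| ≤ ε := by
  obtain ⟨b, hab, hb⟩ := (mem_nhdsGT_iff_exists_Ioc_subset).1
    (Metric.tendsto_nhds.1 (μ.tendsto_cdf_nhdsGT a) ε hε)
  filter_upwards [Ioc_mem_nhdsGT (tsub_pos_of_lt hab)] with δ hδ
  have hδ' : (0 : ℝ) < δ := hδ.1
  rw [signedIntegral_ramp_sub_cdf μ a hδ.1, abs_mul, abs_of_pos (inv_pos.2 hδ'),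
    inv_mul_le_iff₀ hδ', ← Real.norm_eq_abs]
  have hle := norm_setIntegral_le_of_norm_le_const (μ := (volume : Measure ℝ≥0))
    (s := Set.Ioc a (a + δ)) (f := fun x => μ.cdf x - μ.cdf a) (C := ε)
    (by rw [volume_Ioc_nnreal]; exact ENNReal.coe_lt_top) ?_
  · rw [Measure.real, volume_Ioc_nnreal, ENNReal.coe_toReal] at hle
    linarith
  · intro x hx
    have hxb : x ∈ Set.Ioc a b := ⟨hx.1, hx.2.trans (by
      have := add_le_add_right hδ.2 a
      rwa [add_tsub_cancel_of_le hab.le] at this)⟩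
    exact (le_of_lt (hb hxb))

theorem tendsto_distribution_of_tendsto_laplace {μn : ℕ → GenSignedRadonMeasure}
    {μ : GenSignedRadonMeasure} (hμn : ∀ n, (μn n).HasLaplace) (hμ : μ.HasLaplace)
    (hbdd : limsup (fun n => (((μn n).abs.laplace 1 : ℝ) : EReal)) atTop < ⊤)
    (hΨ : ∀ l : ℝ, 0 < l → Tendsto (fun n => (μn n).laplace l) atTop (𝓝 (μ.laplace l)))
    {a : ℝ≥0} (h : RightEquicontinuousAt μn a) :
    Tendsto (fun n => (μn n).distribution a) atTop (𝓝 (μ.distribution a)) := by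
  -- At `0` all distribution functions vanish by convention.
  rcases eq_or_ne a 0 with rfl | ha
  · simp [distribution]
  simp_rw [fun ν : GenSignedRadonMeasure => ν.distribution_eq_cdf ha]
  rw [Metric.tendsto_nhds]
  intro ε hε
  obtain ⟨r, hr, hnear⟩ := h.eventually_signedIntegral_ramp_near hμn hbdd
    (show 0 < ε / 4 by positivity)
  obtain ⟨δ, hδμ, hδ⟩ := ((μ.eventually_abs_signedIntegral_ramp_sub_cdf_le a
    (show 0 < ε / 4 by positivity)).and (Ioo_mem_nhdsGT hr)).exists
  have hlim := tendsto_signedIntegral_of_tendsto_laplace hμn hμ hbdd hΨ (continuous_ramp a δ)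
    (fun x => ramp_eq_zero)
  filter_upwards [hnear δ hδ.1 hδ.2, Metric.tendsto_nhds.1 hlim (ε / 4) (by positivity)]
    with n h1 h2
  rw [Real.dist_eq] at h2 ⊢
  rw [abs_lt] at h2 ⊢
  rw [abs_le] at h1 hδμ
  constructor <;> linarith [h1.1, h1.2, h2.1, h2.2, hδμ.1, hδμ.2]

end GenSignedRadonMeasure

theorem mainTheorem1 (μn : ℕ → GenSignedRadonMeasure) (μ : GenSignedRadonMeasure)
    (hμn : ∀ n, (μn n).HasLaplace) (hμ : μ.HasLaplace)
    (hbdd : ∀ l : ℝ, 0 < l →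
      limsup (fun n => (((μn n).abs.laplace l : ℝ) : EReal)) atTop < ⊤) :
    ((∀ l : ℝ, 0 < l → Tendsto (fun n => (μn n).laplace l) atTop (𝓝 (μ.laplace l))) →
      ∀ x : ℝ≥0, μ.IsContinuityPoint x →
        GenSignedRadonMeasure.RightEquicontinuousAt μn x →
        Tendsto (fun n => (μn n).distribution x) atTop (𝓝 (μ.distribution x))) ∧
    ((∀ᵐ x : ℝ≥0 ∂((volume : Measure ℝ).comap ((↑) : ℝ≥0 → ℝ)),
        Tendsto (fun n => (μn n).distribution x) atTop (𝓝 (μ.distribution x))) →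
      ∀ l : ℝ, 0 < l → Tendsto (fun n => (μn n).laplace l) atTop (𝓝 (μ.laplace l))) :=
  ⟨fun hΨ _ _ hx => GenSignedRadonMeasure.tendsto_distribution_of_tendsto_laplace hμn hμ
      (hbdd 1 one_pos) hΨ hx,
    fun hF _ hl => GenSignedRadonMeasure.tendsto_laplace_of_ae_tendsto_distribution hμn hμ
      hbdd hF hl⟩
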